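/- Let $n\in\mathbb{N}$ and let $\phi:\mathbb{R}^n\to\mathbb{R}$ be a strictly convex function of class $\mathcal{C}^1$ such that $\phi(x)/\|x\|\to+\infty$ as $\|x\|\to\infty$ and $\int_{\mathbb{R}^n}e^{-\phi(x)}\,dx=1$, where $\|\cdot\|$ is the Euclidean norm and $dx$ is Lebesgue measure. Write $\phi^*(x)=\sup_{z\in\mathbb{R}^n}\{x\cdot z-\phi(z)\}$ for the Fenchel–Legendre transform of $\phi$, and $\mathrm{Ent}_{dx}(f)=\int f\log\frac{f}{\int f\,dx}\,dx$ for the entropy with respect to Lebesgue measure. Then for every $\lambda>0$ and every $\mathcal{C}^1$ function $g:\mathbb{R}^n\to\mathbb{R}$ such that $e^g$, $g\,e^g$ and $\phi^*(-\lambda\nabla g)\,e^g$ are Lebesgue integrable, $$\mathrm{Ent}_{dx}(e^g)\le -n\log(\lambda e)\int e^g\,dx+\int\phi^*(-\lambda\nabla g)\,e^g\,dx .$$ The inequality is optimal in the following sense: for every $\bar x\in\mathbb{R}^n$, if $g(x)=-\phi(x-\bar x)$ and $\lambda=1$, then the functions $e^g$, $g\,e^g$ and $\phi^*(-\nabla g)\,e^g$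 are integrable and equality holds. -/

import Mathlib

open MeasureTheory Filter

/-- The entropy `Ent_μ(f) = ∫ f log (f / ∫ f dμ) dμ`. -/
noncomputable def entropy {α : Type*} [MeasurableSpace α] (μ : Measure α) (f : α → ℝ) : ℝ :=
  ∫ x, f x * Real.log (f x / ∫ y, f y ∂μ) ∂μ

/-- The Fenchel-Legendre transform `φ*(x) = sup_z (x · z - φ z)`. The supremum is taken in `ℝ`;
for a superlinear continuous `φ` it is finite, see `bddAbove_legendre`. -/
noncomputable def legendre {n : ℕ} (φ : EuclideanSpace ℝ (Fin n) → ℝ)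
    (x : EuclideanSpace ℝ (Fin n)) : ℝ :=
  ⨆ z : EuclideanSpace ℝ (Fin n), (inner ℝ x z - φ z)

/-- The supremum defining `legendre φ x` is that of a set bounded above. -/
theorem bddAbove_legendre {n : ℕ} {φ : EuclideanSpace ℝ (Fin n) → ℝ} (hc : Continuous φ)
    (hlim : Tendsto (fun x => φ x / ‖x‖) (cocompact (EuclideanSpace ℝ (Fin n))) atTop)
    (x : EuclideanSpace ℝ (Fin n)) :
    BddAbove (Set.range fun z : EuclideanSpace ℝ (Fin n) => inner ℝ x z - φ z) := by
  have h := hlim.eventually_ge_atTop ‖x‖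
  obtain ⟨K, hK, hKs⟩ := mem_cocompact.1 h
  have hcont : Continuous fun z : EuclideanSpace ℝ (Fin n) => inner ℝ x z - φ z := by fun_prop
  obtain ⟨B, hB⟩ := (hK.image hcont).bddAbove
  refine ⟨max B (max 0 (inner ℝ x 0 - φ 0)), ?_⟩
  rintro _ ⟨z, rfl⟩
  by_cases hz : z ∈ K
  · exact (hB ⟨z, hz, rfl⟩).trans (le_max_left _ _)
  · rcases eq_or_ne z 0 with rfl | h0
    · exact (le_max_right _ _).trans (le_max_right _ _)
    · have h1 : ‖x‖ ≤ φ z / ‖z‖ := hKs hz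
      rw [le_div_iff₀ (norm_pos_iff.2 h0)] at h1
      have h2 := real_inner_le_norm x z
      have h3 : inner ℝ x z - φ z ≤ 0 := by linarith
      exact h3.trans ((le_max_left _ _).trans (le_max_right _ _))

/-! The inequality is the derivative at `t = 0` of Prékopa-Leindler. Take weights `1 - t` and `t`,
the functions `f ((1 - t) • x) ^ (1 / (1 - t))` with `f = exp g`, and `exp (-φ)`. The upper function
is the supremum over `y` of `exp (g (z - t • y) - t * φ y)`, to first order `exp (g z + t * φ*(-∇g
z))`. The left side expands as `F + t * (Ent f + n * F + F * log ∫ exp (-φ))`, with `F = ∫ f`;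
comparing the terms in `t` gives the case `λ = 1`. Replacing `φ` by `φ (· / λ)` multiplies `∫ exp
(-φ)` by `λ ^ n` and turns `φ*` into `φ* (λ ·)`.

To make the expansion rigorous, `f` is cut off to compact support and `exp (-φ)` to a ball
(`entropy_cutoff_le_add`). Both cutoffs are then removed by limits of integrals.

For `g = -φ (· - x̄)`, equality amounts to `∫ φ*(∇φ) exp (-φ) = n - ∫ φ exp (-φ)`. Only `≤` is
missing. It comes from differentiating `∫ exp (-φ ((1 - ε) • x)) = (1 - ε) ^ (-n)` at `ε = 0`, where
convexity makes Fatou's lemma applicable. -/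

/-! ### The Prékopa-Leindler inequality -/

open Set in
/-- The Brunn-Minkowski inequality on the line, with weights. -/
theorem volume_brunnMinkowski_real {a b : ℝ} (ha : 0 < a) (hb : 0 < b) {A B C : Set ℝ}
    (hA : MeasurableSet A) (hB : MeasurableSet B)
    (hA' : A.Nonempty) (hB' : B.Nonempty) (h : ∀ x ∈ A, ∀ y ∈ B, a * x + b * y ∈ C) :
    ENNReal.ofReal a * volume A + ENNReal.ofReal b * volume B ≤ volume C := by
  have compact_case : ∀ K L : Set ℝ, IsCompact K → IsCompact L → K ⊆ A → L ⊆ B →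
      K.Nonempty → L.Nonempty →
      ENNReal.ofReal a * volume K + ENNReal.ofReal b * volume L ≤ volume C := by
    intro K L hK hL hKA hLB hK' hL'
    obtain ⟨k, hk, hkmax⟩ := hK.exists_isGreatest hK'
    obtain ⟨l, hl, hlmin⟩ := hL.exists_isLeast hL'
    have scale : ∀ (c d : ℝ) (S T : Set ℝ), 0 < c → (∀ x ∈ S, c * x + d ∈ T) →
        ENNReal.ofReal c * volume S ≤ volume T := by
      intro c d S T hc hST
      have h1 : S ⊆ (c * ·) ⁻¹' ((· + d) ⁻¹' T) := fun x hx => hST x hx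
      have h2 := measure_mono (μ := volume) h1
      rw [Real.volume_preimage_mul_left hc.ne', measure_preimage_add_right,
        abs_of_pos (inv_pos.2 hc)] at h2
      calc ENNReal.ofReal c * volume S
          ≤ ENNReal.ofReal c * (ENNReal.ofReal c⁻¹ * volume T) := by gcongr
        _ = volume T := by
          rw [← mul_assoc, ← ENNReal.ofReal_mul hc.le, mul_inv_cancel₀ hc.ne']; simp
    -- The sets `a K + b l` and `a k + b L`, with `k = max K` and `l = min L`, lie on opposite sides
    -- of `a k + b l`, so their measures add up inside `C`.
    have h1 : ENNReal.ofReal a * volume K ≤ volume (C ∩ Iic (a * k + b * l)) := by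
      refine scale a (b * l) _ _ ha fun x hx => ⟨h x (hKA hx) l (hLB hl), ?_⟩
      have := mul_le_mul_of_nonneg_left (hkmax hx) ha.le
      simp only [mem_Iic]; linarith
    have h2 : ENNReal.ofReal b * volume L ≤ volume (C \ Iic (a * k + b * l)) := by
      have : volume (C \ Iic (a * k + b * l)) = volume (C ∩ Ici (a * k + b * l)) := by
        rw [sdiff_eq, compl_Iic]
        exact measure_congr ((ae_eq_refl _).inter Ioi_ae_eq_Ici)
      rw [this]
      refine scale b (a * k) _ _ hb fun y hy => ⟨?_, ?_⟩
      · rw [add_comm]; exact h k (hKA hk) y (hLB hy)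
      · have := mul_le_mul_of_nonneg_left (hlmin hy) hb.le
        simp only [mem_Ici]; linarith
    exact (add_le_add h1 h2).trans (measure_inter_add_sdiff C measurableSet_Iic).le
  obtain ⟨x₀, hx₀⟩ := hA'
  obtain ⟨y₀, hy₀⟩ := hB'
  rw [hA.measure_eq_iSup_isCompact, hB.measure_eq_iSup_isCompact]
  simp only [ENNReal.mul_iSup, iSup_and']
  refine ENNReal.biSup_add_biSup_le' ⟨∅, empty_subset _, isCompact_empty⟩
    ⟨∅, empty_subset _, isCompact_empty⟩ fun K hK L hL => ?_
  -- The compact sets from inner regularity may be empty; adding a point of `A` and one of `B` makes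
  -- `compact_case` apply.
  refine le_trans ?_ (compact_case (insert x₀ K) (insert y₀ L) (hK.2.insert _) (hL.2.insert _)
    (insert_subset hx₀ hK.1) (insert_subset hy₀ hL.1) (insert_nonempty _ _) (insert_nonempty _ _))
  gcongr <;> exact subset_insert _ _

-- Levels are restricted to `(0, 1)` because the one-dimensional Brunn-Minkowski inequality needs
-- nonempty level sets.
open Set in
theorem lintegral_eq_lintegral_meas_lt_of_le_one {α : Type*} [MeasurableSpace α] (μ : Measure α)
    {f : α → ENNReal} (hf : Measurable f) (hf1 : ∀ x, f x ≤ 1) :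
    ∫⁻ x, f x ∂μ = ∫⁻ s in Ioo (0 : ℝ) 1, μ {x | ENNReal.ofReal s < f x} := by
  have hfin : ∀ x, f x ≠ ⊤ := fun x => ((hf1 x).trans_lt ENNReal.one_lt_top).ne
  have h := lintegral_eq_lintegral_meas_lt μ (f := fun x => (f x).toReal)
    (ae_of_all _ fun _ => ENNReal.toReal_nonneg) hf.ennreal_toReal.aemeasurable
  simp only [ENNReal.ofReal_toReal (hfin _)] at h
  rw [h, ← Ioo_union_Ici_eq_Ioi (zero_lt_one' ℝ), lintegral_union measurableSet_Ici]
  · have h0 : ∫⁻ s in Ici (1 : ℝ), μ {x | s < (f x).toReal} = 0 := by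
      rw [setLIntegral_congr_fun (g := fun _ => 0) measurableSet_Ici]
      · simp
      · intro s hs
        have : {x | s < (f x).toReal} = ∅ := by
          ext x
          have h1 := ENNReal.toReal_mono ENNReal.one_ne_top (hf1 x)
          simp only [ENNReal.toReal_one] at h1
          simpa using h1.trans hs
        simp [this]
    rw [h0, add_zero]
    refine setLIntegral_congr_fun measurableSet_Ioo fun s hs => ?_
    simp only [ENNReal.ofReal_lt_iff_lt_toReal hs.1.le (hfin _)]
  · exact disjoint_left.2 fun x hx hx' => not_lt.2 hx' hx.2

-- With both suprema equal to `1`, the sets `{f > s}` and `{g > s}` are nonempty for every `s < 1`,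
-- and their weighted sum lies in `{h > s}`. Brunn-Minkowski at each level, integrated over `s`,
-- bounds the arithmetic mean of the integrals, which dominates the geometric one.
open Set in
theorem prekopaLeindler_real_of_iSup_eq_one {a b : ℝ} (ha : 0 < a) (hb : 0 < b) (hab : a + b = 1)
    {f g h : ℝ → ENNReal} (hf : Measurable f) (hg : Measurable g) (hh : Measurable h)
    (hf1 : ⨆ x, f x = 1) (hg1 : ⨆ x, g x = 1)
    (hfgh : ∀ x y, f x ^ a * g y ^ b ≤ h (a * x + b * y)) :
    (∫⁻ x, f x) ^ a * (∫⁻ x, g x) ^ b ≤ ∫⁻ x, h x := by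
  have hmin : ∫⁻ x, min (h x) 1 ≤ ∫⁻ x, h x := lintegral_mono fun x => min_le_left _ _
  refine le_trans ?_ hmin
  have amgm : (∫⁻ x, f x) ^ a * (∫⁻ x, g x) ^ b ≤
      ENNReal.ofReal a * (∫⁻ x, f x) + ENNReal.ofReal b * (∫⁻ x, g x) := by
    rcases eq_or_ne (∫⁻ x, f x) ⊤ with hF | hF
    · simp [hF, ENNReal.mul_top, ha]
    rcases eq_or_ne (∫⁻ x, g x) ⊤ with hG | hG
    · simp [hG, ENNReal.mul_top, hb]
    rw [← ENNReal.ofReal_toReal hF, ← ENNReal.ofReal_toReal hG,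
      ENNReal.ofReal_rpow_of_nonneg ENNReal.toReal_nonneg ha.le,
      ENNReal.ofReal_rpow_of_nonneg ENNReal.toReal_nonneg hb.le,
      ← ENNReal.ofReal_mul (by positivity), ← ENNReal.ofReal_mul ha.le, ← ENNReal.ofReal_mul hb.le,
      ← ENNReal.ofReal_add (by positivity) (by positivity)]
    exact ENNReal.ofReal_le_ofReal (Real.geom_mean_le_arith_mean2_weighted ha.le hb.le
      ENNReal.toReal_nonneg ENNReal.toReal_nonneg hab)
  refine amgm.trans ?_
  rw [lintegral_eq_lintegral_meas_lt_of_le_one volume hf fun x => (le_iSup f x).trans hf1.le,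
    lintegral_eq_lintegral_meas_lt_of_le_one volume hg fun x => (le_iSup g x).trans hg1.le,
    lintegral_eq_lintegral_meas_lt_of_le_one volume (hh.min measurable_const)
      fun x => min_le_right _ _]
  have anti : ∀ f : ℝ → ENNReal, Measurable fun s : ℝ => volume {x | ENNReal.ofReal s < f x} :=
    fun f => Antitone.measurable fun s t hst => measure_mono fun x hx =>
      (ENNReal.ofReal_le_ofReal hst).trans_lt hx
  rw [← lintegral_const_mul _ (anti f), ← lintegral_const_mul _ (anti g),
    ← lintegral_add_left ((anti f).const_mul _)]
  refine setLIntegral_mono (anti _) fun s hs => ?_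
  have hs1 : ENNReal.ofReal s < 1 := by
    rw [← ENNReal.ofReal_one]; exact (ENNReal.ofReal_lt_ofReal_iff one_pos).2 hs.2
  have exists_lt : ∀ f : ℝ → ENNReal, ⨆ x, f x = 1 → ∃ x, ENNReal.ofReal s < f x :=
    fun f hf => lt_iSup_iff.1 (hf.symm ▸ hs1)
  have hs0 : ENNReal.ofReal s ≠ 0 := by simpa using hs.1
  refine volume_brunnMinkowski_real ha hb (measurableSet_lt measurable_const hf)
    (measurableSet_lt measurable_const hg) (exists_lt f hf1) (exists_lt g hg1)
    fun x hx y hy => lt_min (lt_of_lt_of_le ?_ (hfgh x y)) hs1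
  calc ENNReal.ofReal s = ENNReal.ofReal s ^ a * ENNReal.ofReal s ^ b := by
        rw [← ENNReal.rpow_add _ _ hs0 ENNReal.ofReal_ne_top, hab, ENNReal.rpow_one]
    _ < f x ^ a * g y ^ b :=
        ENNReal.mul_lt_mul (ENNReal.rpow_lt_rpow hx ha) (ENNReal.rpow_lt_rpow hy hb)

theorem prekopaLeindler_real_of_bounded {a b : ℝ} (ha : 0 < a) (hb : 0 < b) (hab : a + b = 1)
    {f g h : ℝ → ENNReal} (hf : Measurable f) (hg : Measurable g) (hh : Measurable h)
    (hf1 : ⨆ x, f x ≠ ⊤) (hg1 : ⨆ x, g x ≠ ⊤)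
    (hfgh : ∀ x y, f x ^ a * g y ^ b ≤ h (a * x + b * y)) :
    (∫⁻ x, f x) ^ a * (∫⁻ x, g x) ^ b ≤ ∫⁻ x, h x := by
  rcases eq_or_ne (⨆ x, f x) 0 with hf0 | hf0
  · have : ∀ x, f x = 0 := by simpa using hf0
    simp [this, ha]
  rcases eq_or_ne (⨆ x, g x) 0 with hg0 | hg0
  · have : ∀ x, g x = 0 := by simpa using hg0
    simp [this, hb]
  set P := ⨆ x, f x
  set Q := ⨆ x, g x
  have hP : P⁻¹ ≠ ⊤ := ENNReal.inv_ne_top.2 hf0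
  have hQ : Q⁻¹ ≠ ⊤ := ENNReal.inv_ne_top.2 hg0
  have hP0 : P⁻¹ ≠ 0 := ENNReal.inv_ne_zero.2 hf1
  have hQ0 : Q⁻¹ ≠ 0 := ENNReal.inv_ne_zero.2 hg1
  have hc : P⁻¹ ^ a * Q⁻¹ ^ b ≠ ⊤ := ENNReal.mul_ne_top
    (ENNReal.rpow_ne_top_of_nonneg ha.le hP) (ENNReal.rpow_ne_top_of_nonneg hb.le hQ)
  have hc0 : P⁻¹ ^ a * Q⁻¹ ^ b ≠ 0 := mul_ne_zero
    (ENNReal.rpow_pos hP0.bot_lt hP).ne' (ENNReal.rpow_pos hQ0.bot_lt hQ).ne'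
  have key := prekopaLeindler_real_of_iSup_eq_one ha hb hab (hf.const_mul P⁻¹) (hg.const_mul Q⁻¹)
    (hh.const_mul (P⁻¹ ^ a * Q⁻¹ ^ b))
    (by rw [← ENNReal.mul_iSup]; exact ENNReal.inv_mul_cancel hf0 hf1)
    (by rw [← ENNReal.mul_iSup]; exact ENNReal.inv_mul_cancel hg0 hg1) (fun x y => by
      rw [ENNReal.mul_rpow_of_nonneg _ _ ha.le, ENNReal.mul_rpow_of_nonneg _ _ hb.le,
        mul_mul_mul_comm]
      gcongr
      exact hfgh x y)
  rw [lintegral_const_mul _ hf, lintegral_const_mul _ hg, lintegral_const_mul _ hh,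
    ENNReal.mul_rpow_of_nonneg _ _ ha.le, ENNReal.mul_rpow_of_nonneg _ _ hb.le,
    mul_mul_mul_comm] at key
  exact (ENNReal.mul_le_mul_iff_right hc0 hc).1 key

theorem prekopaLeindler_real {a b : ℝ} (ha : 0 < a) (hb : 0 < b) (hab : a + b = 1)
    {f g h : ℝ → ENNReal} (hf : Measurable f) (hg : Measurable g) (hh : Measurable h)
    (hfgh : ∀ x y, f x ^ a * g y ^ b ≤ h (a * x + b * y)) :
    (∫⁻ x, f x) ^ a * (∫⁻ x, g x) ^ b ≤ ∫⁻ x, h x := by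
  -- Zero integrals are set aside because multiplication on `ENNReal` is discontinuous at `0 * ⊤`,
  -- and the limit below is of a product.
  rcases eq_or_ne (∫⁻ x, f x) 0 with hf0 | hf0
  · simp [hf0, ha]
  rcases eq_or_ne (∫⁻ x, g x) 0 with hg0 | hg0
  · simp [hg0, hb]
  have trunc : ∀ f : ℝ → ENNReal, Measurable f →
      Tendsto (fun N : ℕ => ∫⁻ x, min (f x) N) atTop (nhds (∫⁻ x, f x)) := by
    intro f hf
    refine lintegral_tendsto_of_tendsto_of_monotone (fun N => (hf.min measurable_const).aemeasurable)
      (ae_of_all _ fun x M N hMN => ?_) (ae_of_all _ fun x => ?_)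
    · exact min_le_min_left _ (by exact_mod_cast hMN)
    · have := (tendsto_const_nhds (x := f x)).min ENNReal.tendsto_nat_nhds_top
      simpa using this
  refine le_of_tendsto (ENNReal.Tendsto.mul ((trunc f hf).ennrpow_const a)
    (Or.inl ?_) ((trunc g hg).ennrpow_const b) (Or.inl ?_)) (Eventually.of_forall fun N => ?_)
  · simp [ENNReal.rpow_eq_zero_iff, hf0, ha.le]
  · simp [ENNReal.rpow_eq_zero_iff, hg0, hb.le]
  · refine prekopaLeindler_real_of_bounded ha hb hab (hf.min measurable_const)
      (hg.min measurable_const) hh ?_ ?_ fun x y => le_trans ?_ (hfgh x y)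
    · exact ((iSup_le fun x => min_le_right _ _).trans_lt (ENNReal.natCast_lt_top N)).ne
    · exact ((iSup_le fun x => min_le_right _ _).trans_lt (ENNReal.natCast_lt_top N)).ne
    · gcongr <;> exact min_le_left _ _

/-- Induction on dimension: for fixed first coordinates, the inequality in dimension `n` says that
the slice integrals satisfy the hypothesis of the one-dimensional inequality. -/
theorem prekopaLeindler_pi {a b : ℝ} (ha : 0 < a) (hb : 0 < b) (hab : a + b = 1) (n : ℕ) :
    ∀ {f g h : (Fin n → ℝ) → ENNReal}, Measurable f → Measurable g → Measurable h →
    (∀ x y, f x ^ a * g y ^ b ≤ h (a • x + b • y)) →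
    (∫⁻ x, f x) ^ a * (∫⁻ x, g x) ^ b ≤ ∫⁻ x, h x := by
  induction n with
  | zero =>
    intro f g h hf hg hh hfgh
    rw [Measure.volume_pi_eq_dirac (0 : Fin 0 → ℝ)]
    simp only [lintegral_dirac]
    simpa using hfgh 0 0
  | succ n ih =>
    intro f g h hf hg hh hfgh
    have cons_eq : ∀ p : ℝ × (Fin n → ℝ), (Fin.cons p.1 p.2 : Fin (n + 1) → ℝ) =
        (MeasurableEquiv.piFinSuccAbove (fun _ : Fin (n + 1) => ℝ) 0).symm p := fun p => by
      simp [MeasurableEquiv.piFinSuccAbove]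
      rfl
    have cons_meas : Measurable fun p : ℝ × (Fin n → ℝ) =>
        (Fin.cons p.1 p.2 : Fin (n + 1) → ℝ) := by
      simp only [cons_eq]
      exact MeasurableEquiv.measurable _
    have split : ∀ f : (Fin (n + 1) → ℝ) → ENNReal, Measurable f →
        ∫⁻ x, f x = ∫⁻ s : ℝ, ∫⁻ x : Fin n → ℝ, f (Fin.cons s x) := by
      intro f hf
      rw [← (volume_preserving_piFinSuccAbove (fun _ : Fin (n + 1) => ℝ) 0).symm.lintegral_comp hf]
      simp only [← cons_eq]
      exact lintegral_prod _ (hf.comp cons_meas).aemeasurable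
    have slice : ∀ f : (Fin (n + 1) → ℝ) → ENNReal, Measurable f →
        Measurable fun s : ℝ => ∫⁻ x : Fin n → ℝ, f (Fin.cons s x) := fun f hf =>
      (hf.comp cons_meas).lintegral_prod_right'
    have slice' : ∀ (f : (Fin (n + 1) → ℝ) → ENNReal) (s : ℝ), Measurable f →
        Measurable fun x : Fin n → ℝ => f (Fin.cons s x) := fun f s hf =>
      hf.comp (cons_meas.comp measurable_prodMk_left)
    rw [split f hf, split g hg, split h hh]
    refine prekopaLeindler_real ha hb hab (slice f hf) (slice g hg) (slice h hh) fun s r => ?_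
    refine ih (slice' f s hf) (slice' g r hg) (slice' h _ hh) fun x y => ?_
    convert hfgh (Fin.cons s x) (Fin.cons r y) using 2
    ext i
    refine Fin.cases ?_ (fun j => ?_) i <;> simp

/-- The Prékopa-Leindler inequality in Euclidean space. -/
theorem prekopaLeindler {n : ℕ} {a b : ℝ} (ha : 0 < a) (hb : 0 < b) (hab : a + b = 1)
    {f g h : EuclideanSpace ℝ (Fin n) → ENNReal} (hf : Measurable f) (hg : Measurable g)
    (hh : Measurable h) (hfgh : ∀ x y, f x ^ a * g y ^ b ≤ h (a • x + b • y)) :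
    (∫⁻ x, f x) ^ a * (∫⁻ x, g x) ^ b ≤ ∫⁻ x, h x := by
  have vp := PiLp.volume_preserving_toLp (Fin n)
  rw [← vp.lintegral_comp hf, ← vp.lintegral_comp hg, ← vp.lintegral_comp hh]
  exact prekopaLeindler_pi ha hb hab n (hf.comp vp.measurable) (hg.comp vp.measurable)
    (hh.comp vp.measurable) fun x y => hfgh _ _

/-! ### Entropy from Prékopa-Leindler at small `t` -/

/-- Jensen's inequality for `exp` under the probability density `f / ∫ f`. The tangent line is taken
at the mean `c` of `log f`, so the linear term integrates to zero. -/
theorem mul_exp_le_integral_rpow {α : Type*} [MeasurableSpace α] {μ : Measure α} {f : α → ℝ} {s : ℝ}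
    (hf0 : ∀ x, 0 ≤ f x) (hs : 0 ≤ s) (hf : Integrable f μ)
    (hfl : Integrable (fun x => f x * Real.log (f x)) μ)
    (hfs : Integrable (fun x => f x ^ (1 + s)) μ) (hF : 0 < ∫ x, f x ∂μ) :
    (∫ x, f x ∂μ) * Real.exp (s * ((∫ x, f x * Real.log (f x) ∂μ) / ∫ x, f x ∂μ)) ≤
      ∫ x, f x ^ (1 + s) ∂μ := by
  set F := ∫ x, f x ∂μ
  set c := (∫ x, f x * Real.log (f x) ∂μ) / F with hc
  have hcF : ∫ x, f x * Real.log (f x) ∂μ = c * F := by rw [hc]; field_simp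
  have hfc : Integrable (fun x => s * (f x * Real.log (f x) - c * f x)) μ :=
    (hfl.sub (hf.const_mul c)).const_mul s
  have h1 : ∫ x, Real.exp (s * c) * (f x + s * (f x * Real.log (f x) - c * f x)) ∂μ =
      F * Real.exp (s * c) := by
    rw [integral_const_mul, integral_add hf hfc,
      integral_const_mul, integral_sub hfl (hf.const_mul c), integral_const_mul, hcF]
    ring
  rw [← h1]
  refine integral_mono ((hf.add hfc).const_mul _) hfs
    fun x => ?_
  rcases (hf0 x).eq_or_lt with h0 | h0
  · have : (1 + s) ≠ 0 := by positivity
    simp [← h0, Real.zero_rpow this]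
  · have h2 : f x ^ (1 + s) =
        f x * (Real.exp (s * c) * Real.exp (s * (Real.log (f x) - c))) := by
      rw [Real.rpow_add h0, Real.rpow_one, Real.rpow_def_of_pos h0, ← Real.exp_add]
      ring_nf
    have h3 := Real.add_one_le_exp (s * (Real.log (f x) - c))
    show Real.exp (s * c) * (f x + s * (f x * Real.log (f x) - c * f x)) ≤ f x ^ (1 + s)
    rw [h2]
    calc _ = f x * (Real.exp (s * c) * (s * (Real.log (f x) - c) + 1)) := by ring
      _ ≤ _ := by gcongr

/-- The Prékopa-Leindler inequality applied to `f ((1 - t) • x) ^ (1 / (1 - t))` and `u`, its left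
side bounded below to first order in `t` by Jensen's inequality. -/
theorem entropy_add_le_integral_supConvolution {n : ℕ} {t : ℝ} (ht0 : 0 < t) (ht1 : t < 1)
    {f u h : EuclideanSpace ℝ (Fin n) → ℝ} (hf : Continuous f) (hfc : HasCompactSupport f)
    (hf0 : ∀ x, 0 ≤ f x) (hF : 0 < ∫ x, f x)
    (hum : Measurable u) (hu : Integrable u) (hu0 : ∀ x, 0 ≤ u x) (hU : 0 < ∫ x, u x)
    (hhm : Measurable h) (hh : Integrable h) (hh0 : ∀ x, 0 ≤ h x)
    (hfuh : ∀ z y, f (z - t • y) * u y ^ t ≤ h z) :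
    (∫ x, f x) + t * ((∫ x, f x * Real.log (f x)) - (∫ x, f x) * Real.log (∫ x, f x)
      + n * (1 - t) * (∫ x, f x) + (∫ x, f x) * Real.log (∫ x, u x)) ≤ ∫ x, h x := by
  have ht : 0 < 1 - t := by linarith
  -- Chosen so that `1 + s = 1 / (1 - t)`.
  set s := t / (1 - t) with hs
  have hs0 : 0 ≤ s := by positivity
  have hs1 : (1 + s) * (1 - t) = 1 := by rw [hs]; field_simp; ring
  have hs2 : (1 - t) * s = t := by rw [hs]; field_simp
  have hfi : Integrable f := hf.integrable_of_hasCompactSupport hfc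
  have hfl : Integrable (fun x => f x * Real.log (f x)) :=
    (Real.continuous_mul_log.comp hf).integrable_of_hasCompactSupport hfc.mul_right
  have hps : Continuous fun x => f x ^ (1 + s) := hf.rpow_const fun x => Or.inr (by positivity)
  have hpc : HasCompactSupport fun x => f x ^ (1 + s) :=
    hfc.comp_left (g := fun x : ℝ => x ^ (1 + s)) (Real.zero_rpow (by positivity))
  have hfs : Integrable fun x => f x ^ (1 + s) := hps.integrable_of_hasCompactSupport hpc
  have hlow := mul_exp_le_integral_rpow hf0 hs0 hfi hfl hfs hF
  set F := ∫ x, f x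
  set L := ∫ x, f x * Real.log (f x)
  set U := ∫ x, u x
  have hvi : Integrable fun x => f ((1 - t) • x) ^ (1 + s) := hfs.comp_smul ht.ne'
  have hv0 : ∀ x, 0 ≤ f ((1 - t) • x) ^ (1 + s) := fun x => Real.rpow_nonneg (hf0 _) _
  have hV : ∫ x, f ((1 - t) • x) ^ (1 + s) = ((1 - t) ^ n)⁻¹ * ∫ x, f x ^ (1 + s) := by
    rw [Measure.integral_comp_smul volume (fun x => f x ^ (1 + s)), finrank_euclideanSpace_fin,
      abs_of_pos (by positivity), smul_eq_mul]
  have hPL := prekopaLeindler (n := n) (a := 1 - t) (b := t) ht ht0 (by ring)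
    (f := fun x => ENNReal.ofReal (f ((1 - t) • x) ^ (1 + s))) (g := fun x => ENNReal.ofReal (u x))
    (h := fun x => ENNReal.ofReal (h x))
    ((hps.comp (continuous_const_smul (1 - t))).measurable.ennreal_ofReal)
    hum.ennreal_ofReal hhm.ennreal_ofReal (fun x y => by
      rw [ENNReal.ofReal_rpow_of_nonneg (hv0 x) ht.le, ENNReal.ofReal_rpow_of_nonneg (hu0 y) ht0.le,
        ← ENNReal.ofReal_mul (Real.rpow_nonneg (hv0 x) _), ← Real.rpow_mul (hf0 _), hs1,
        Real.rpow_one]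
      refine ENNReal.ofReal_le_ofReal ?_
      simpa using hfuh ((1 - t) • x + t • y) y)
  rw [← ofReal_integral_eq_lintegral_ofReal hvi (ae_of_all _ hv0),
    ← ofReal_integral_eq_lintegral_ofReal hu (ae_of_all _ hu0),
    ← ofReal_integral_eq_lintegral_ofReal hh (ae_of_all _ hh0),
    ENNReal.ofReal_rpow_of_nonneg (integral_nonneg hv0) ht.le,
    ENNReal.ofReal_rpow_of_nonneg hU.le ht0.le,
    ← ENNReal.ofReal_mul (Real.rpow_nonneg (integral_nonneg hv0) _),
    ENNReal.ofReal_le_ofReal_iff (integral_nonneg hh0), hV] at hPL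
  refine le_trans ?_ hPL
  set c := L / F with hc
  have hcF : L = c * F := by rw [hc]; field_simp
  -- Combines `hlow` with `exp (n * t) ≤ (1 - t) ^ (-n)`. Since `(1 - t) * s = t`, the exponent is
  -- `log F` plus a multiple of `t`, and `1 + x ≤ exp x` then finishes.
  have h1 : Real.exp ((1 - t) * (n * t + Real.log F + s * c) + t * Real.log U) ≤
      (((1 - t) ^ n)⁻¹ * ∫ x, f x ^ (1 + s)) ^ (1 - t) * U ^ t := by
    rw [Real.exp_add, mul_comm t, ← Real.rpow_def_of_pos hU]
    gcongr
    rw [mul_comm, Real.exp_mul]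
    gcongr
    rw [Real.exp_add, Real.exp_add, Real.exp_log hF, mul_assoc]
    refine mul_le_mul ?_ hlow (by positivity) (by positivity)
    rw [← inv_pow, Real.exp_nat_mul]
    gcongr
    rw [← neg_neg t, Real.exp_neg, neg_neg]
    gcongr
    have := Real.add_one_le_exp (-t)
    linarith
  refine le_trans ?_ h1
  have h2 : (1 - t) * (n * t + Real.log F + s * c) + t * Real.log U =
      Real.log F + t * (n * (1 - t) - Real.log F + c + Real.log U) := by
    linear_combination c * hs2
  rw [h2, Real.exp_add, Real.exp_log hF, hcF]
  have h3 := Real.add_one_le_exp (t * (n * (1 - t) - Real.log F + c + Real.log U))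
  calc _ = F * (t * (n * (1 - t) - Real.log F + c + Real.log U) + 1) := by ring
    _ ≤ _ := by gcongr

/-! ### Regularity of `φ*` and uniform Taylor bounds -/

theorem convexOn_legendre {n : ℕ} {φ : EuclideanSpace ℝ (Fin n) → ℝ} (hc : Continuous φ)
    (hlim : Tendsto (fun x => φ x / ‖x‖) (cocompact (EuclideanSpace ℝ (Fin n))) atTop) :
    ConvexOn ℝ Set.univ (legendre φ) := by
  refine ⟨convex_univ, fun x _ y _ a b ha hb hab => ciSup_le fun z => ?_⟩
  have hx := le_ciSup (bddAbove_legendre hc hlim x) z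
  have hy := le_ciSup (bddAbove_legendre hc hlim y) z
  calc inner ℝ (a • x + b • y) z - φ z
      = a * (inner ℝ x z - φ z) + b * (inner ℝ y z - φ z) := by
        rw [inner_add_left, real_inner_smul_left, real_inner_smul_left]
        linear_combination φ z * hab
    _ ≤ a • legendre φ x + b • legendre φ y := by
        simp only [smul_eq_mul, legendre]; gcongr

/-- A finite convex function on a finite-dimensional space is locally Lipschitz. Continuity makes
`φ*(-∇g)` bounded on balls. -/
theorem continuous_legendre {n : ℕ} {φ : EuclideanSpace ℝ (Fin n) → ℝ} (hc : Continuous φ)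
    (hlim : Tendsto (fun x => φ x / ‖x‖) (cocompact (EuclideanSpace ℝ (Fin n))) atTop) :
    Continuous (legendre φ) :=
  (convexOn_legendre hc hlim).locallyLipschitz.continuous

theorem continuous_gradient {E : Type*} [NormedAddCommGroup E] [InnerProductSpace ℝ E]
    [CompleteSpace E] {g : E → ℝ} (hg : ContDiff ℝ 1 g) : Continuous (gradient g) :=
  (InnerProductSpace.toDual ℝ E).symm.continuous.comp (hg.continuous_fderiv one_ne_zero)

/-- The mean value inequality, with uniform continuity of the derivative on a slightly larger ball,
makes the first-order error at most `t * η` for all `z` and `y` at once. -/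
theorem eventually_comp_sub_smul_le {E : Type*} [NormedAddCommGroup E] [InnerProductSpace ℝ E]
    [FiniteDimensional ℝ E] {g : E → ℝ} (hg : ContDiff ℝ 1 g) {ρ R η : ℝ} (hR : 0 ≤ R)
    (hη : 0 < η) : ∀ᶠ t in nhdsWithin (0 : ℝ) (Set.Ioi 0), ∀ z y : E, ‖z‖ ≤ ρ → ‖y‖ ≤ R →
      g (z - t • y) ≤ g z - t * inner ℝ (gradient g z) y + t * η := by
  -- Radius `ρ + 1` leaves room for displacements `t * R < 1`; dividing by `R + 1` covers `R = 0`.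
  have huc : UniformContinuousOn (fderiv ℝ g) (Metric.closedBall 0 (ρ + 1)) :=
    (isCompact_closedBall _ _).uniformContinuousOn_of_continuous
      (hg.continuous_fderiv one_ne_zero).continuousOn
  obtain ⟨δ, hδ, huc⟩ := Metric.uniformContinuousOn_iff_le.1 huc (η / (R + 1)) (by positivity)
  have hsmall : ∀ᶠ t in nhdsWithin (0 : ℝ) (Set.Ioi 0), t * R < min δ 1 := by
    refine Tendsto.eventually_lt_const (v := 0) (lt_min hδ one_pos) ?_
    have : Continuous fun t : ℝ => t * R := by fun_prop
    simpa using (this.tendsto 0).mono_left nhdsWithin_le_nhds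
  filter_upwards [hsmall, self_mem_nhdsWithin] with t ht ht0 z y hz hy
  have ht0 : 0 < t := ht0
  have hty : ‖t • y‖ ≤ t * R := by rw [norm_smul, Real.norm_of_nonneg ht0.le]; gcongr
  have hmem : z - t • y ∈ Metric.closedBall z (t * R) := by simpa [dist_eq_norm] using hty
  have hmv := (convex_closedBall z (t * R)).norm_image_sub_le_of_norm_hasFDerivWithin_le'
    (f := g) (f' := fderiv ℝ g) (φ := fderiv ℝ g z) (C := η / (R + 1))
    (fun x _ => ((hg.differentiable one_ne_zero) x).hasFDerivAt.hasFDerivWithinAt)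
    (fun x hx => by
      rw [← dist_eq_norm]
      have hxz : dist x z ≤ t * R := hx
      refine huc x ?_ z ?_ (hxz.trans (ht.le.trans (min_le_left _ _)))
      · have h1 : dist x 0 ≤ dist x z + dist z 0 := dist_triangle _ _ _
        rw [dist_zero_right z] at h1
        have := min_le_right δ 1
        simp only [Metric.mem_closedBall]
        linarith
      · simp only [Metric.mem_closedBall, dist_zero_right]; linarith)
    (Metric.mem_closedBall_self (by positivity)) hmem
  have h1 := (le_abs_self _).trans hmv
  have h2 : (fderiv ℝ g z) (z - t • y - z) = -(t * inner ℝ (gradient g z) y) := by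
    rw [inner_gradient_left]
    simp
  rw [h2, show z - t • y - z = -(t • y) by abel, norm_neg] at h1
  have h3 : η / (R + 1) * ‖t • y‖ ≤ t * η := by
    calc η / (R + 1) * ‖t • y‖ ≤ η / (R + 1) * (t * R) := by gcongr
      _ = t * η * (R / (R + 1)) := by ring
      _ ≤ t * η * 1 := by
        gcongr
        exact (div_le_one (by positivity)).2 (by linarith)
      _ = t * η := mul_one _
  linarith

/-- The remainder involves only the bound `K` on `S`, so it stays `O(t ^ 2)` after integration. -/
theorem add_mul_exp_le {χ κ t S K : ℝ} (hχ0 : 0 ≤ χ) (hχ1 : χ ≤ 1) (hκ : 0 ≤ κ) (ht0 : 0 ≤ t)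
    (ht1 : t ≤ 1) (hS : |S| ≤ K) (htK : t * K ≤ 1) :
    (χ + t * κ) * Real.exp (t * S) ≤
      χ + t * (χ * S + κ) + t ^ 2 * (κ * K + K ^ 2 + κ * K ^ 2) := by
  have hK : 0 ≤ K := (abs_nonneg S).trans hS
  have htS : |t * S| ≤ 1 := by
    rw [abs_mul, abs_of_nonneg ht0]
    exact (mul_le_mul_of_nonneg_left hS ht0).trans htK
  have h1 := (abs_le.1 (Real.abs_exp_sub_one_sub_id_le htS)).2
  have h2 : S ^ 2 ≤ K ^ 2 := sq_le_sq' (abs_le.1 hS).1 (abs_le.1 hS).2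
  have h3 : Real.exp (t * S) ≤ 1 + t * S + t ^ 2 * K ^ 2 := by
    have : (t * S) ^ 2 ≤ t ^ 2 * K ^ 2 := by rw [mul_pow]; gcongr
    linarith
  have h4 : κ * S ≤ κ * K := mul_le_mul_of_nonneg_left (abs_le.1 hS).2 hκ
  have h5 : χ * K ^ 2 ≤ 1 * K ^ 2 := by gcongr
  have h6 : t * (κ * K ^ 2) ≤ 1 * (κ * K ^ 2) := by gcongr
  calc (χ + t * κ) * Real.exp (t * S) ≤ (χ + t * κ) * (1 + t * S + t ^ 2 * K ^ 2) := by gcongr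
    _ = χ + t * (χ * S + κ) + t ^ 2 * (κ * S + χ * K ^ 2 + t * (κ * K ^ 2)) := by ring
    _ ≤ χ + t * (χ * S + κ) + t ^ 2 * (κ * K + 1 * K ^ 2 + 1 * (κ * K ^ 2)) := by gcongr
    _ = _ := by ring

/-! ### The inequality with both cutoffs -/

/-- The entropy inequality for the compactly supported `χ * exp g`; the Lipschitz constant `κ` of the
cutoff enters as the error `κ * R * ∫ exp g`. -/
theorem entropy_cutoff_le_add {n : ℕ} {φ g χ : EuclideanSpace ℝ (Fin n) → ℝ} (hφ : Continuous φ)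
    (hφlim : Tendsto (fun x => φ x / ‖x‖) (cocompact (EuclideanSpace ℝ (Fin n))) atTop)
    (hg : ContDiff ℝ 1 g) {R ρ η κ : ℝ} (hR : 0 ≤ R) (hρ : 0 ≤ ρ) (hη : 0 < η) (hκ : 0 ≤ κ)
    (hU : 0 < ∫ x in Metric.closedBall 0 R, Real.exp (-φ x))
    (hχ : Continuous χ) (hχ0 : ∀ x, 0 ≤ χ x) (hχ1 : ∀ x, χ x ≤ 1)
    (hχρ : ∀ x, ρ < ‖x‖ → χ x = 0) (hχκ : ∀ x y, χ x ≤ χ y + κ * ‖x - y‖)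
    (hF : 0 < ∫ x, χ x * Real.exp (g x)) (hgi : Integrable fun x => Real.exp (g x)) :
    (∫ x, χ x * Real.exp (g x) * Real.log (χ x * Real.exp (g x)))
      - (∫ x, χ x * Real.exp (g x)) * Real.log (∫ x, χ x * Real.exp (g x))
      + n * (∫ x, χ x * Real.exp (g x))
      + (∫ x, χ x * Real.exp (g x)) * Real.log (∫ x in Metric.closedBall 0 R, Real.exp (-φ x)) ≤
    (∫ x, χ x * (legendre φ (-gradient g x) * Real.exp (g x))) + κ * R * (∫ x, Real.exp (g x))
      + η * (∫ x, χ x * Real.exp (g x)) := by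
  have hgc : Continuous g := hg.continuous
  have hψ : Continuous fun x => legendre φ (-gradient g x) :=
    (continuous_legendre hφ hφlim).comp (continuous_gradient hg).neg
  set ψ := fun x => legendre φ (-gradient g x)
  set f := fun x => χ x * Real.exp (g x) with hfdef
  have hf : Continuous f := hχ.mul hgc.rexp
  have hχc : HasCompactSupport χ :=
    HasCompactSupport.intro (isCompact_closedBall 0 ρ) fun x hx => hχρ x (by simpa using hx)
  have hfc : HasCompactSupport f := hχc.mul_right
  have hf0 : ∀ x, 0 ≤ f x := fun x => mul_nonneg (hχ0 x) (Real.exp_nonneg _)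
  -- If `‖y‖ ≤ R`, `t < 1` and `χ (z - t • y) ≠ 0`, then `z` lies in this ball.
  set B := Metric.closedBall (0 : EuclideanSpace ℝ (Fin n)) (ρ + R) with hB
  have hBc : IsCompact B := isCompact_closedBall _ _
  have hfB : ∀ x, x ∉ B → χ x = 0 := fun x hx => hχρ x (by
    have : ρ + R < ‖x‖ := by simpa [hB] using hx
    linarith)
  obtain ⟨K, hK⟩ := hBc.exists_bound_of_continuousOn (f := fun x => ψ x + η)
    (hψ.add continuous_const).continuousOn
  have hK : ∀ x ∈ B, |ψ x + η| ≤ K := hK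
  have hK0 : 0 ≤ K := (abs_nonneg _).trans
    (hK 0 (by simp only [hB, Metric.mem_closedBall, dist_self]; positivity))
  set c := κ * R
  have hc : 0 ≤ c := mul_nonneg hκ hR
  set C := c * K + K ^ 2 + c * K ^ 2
  have hC : 0 ≤ C := by positivity
  set I := ∫ x, Real.exp (g x)
  set F := ∫ x, f x
  set L := ∫ x, f x * Real.log (f x)
  set P := ∫ x, χ x * (ψ x * Real.exp (g x))
  set u := fun y => (Metric.closedBall (0 : EuclideanSpace ℝ (Fin n)) R).indicator
    (fun y => Real.exp (-φ y)) y
  have hucont : Continuous fun y => Real.exp (-φ y) := by fun_prop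
  have huint : Integrable u := (integrable_indicator_iff measurableSet_closedBall).2
    (hucont.continuousOn.integrableOn_compact (isCompact_closedBall _ _))
  have huU : ∫ y, u y = ∫ x in Metric.closedBall 0 R, Real.exp (-φ x) :=
    integral_indicator measurableSet_closedBall
  set U := ∫ x in Metric.closedBall 0 R, Real.exp (-φ x)
  -- the inequality up to `O(t)`
  have key : ∀ᶠ t in nhdsWithin (0 : ℝ) (Set.Ioi 0),
      L - F * Real.log F + n * (1 - t) * F + F * Real.log U ≤ P + c * I + η * F + t * (C * I) := by
    have hsmall : ∀ᶠ t in nhdsWithin (0 : ℝ) (Set.Ioi 0), t * K < 1 := by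
      refine Tendsto.eventually_lt_const (v := 0) one_pos ?_
      have : Continuous fun t : ℝ => t * K := by fun_prop
      simpa using (this.tendsto 0).mono_left nhdsWithin_le_nhds
    have hlt1 : ∀ᶠ t in nhdsWithin (0 : ℝ) (Set.Ioi 0), t < 1 :=
      nhdsWithin_le_nhds (eventually_lt_nhds one_pos)
    filter_upwards [eventually_comp_sub_smul_le hg (ρ := ρ + R) hR hη, hsmall, hlt1,
      self_mem_nhdsWithin] with t hTaylor htK ht1 ht0
    have ht0 : 0 < t := ht0
    -- A continuous-on-`B` majorant of the sup-convolution: the Lipschitz bound gives `χ (z - t • y)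
    -- ≤ χ z + t * c`, and Taylor with the definition of `φ*` bounds the exponent.
    set h := B.indicator fun z => (χ z + t * c) * Real.exp (t * (ψ z + η)) * Real.exp (g z) with hh
    have hhc : Continuous fun z => (χ z + t * c) * Real.exp (t * (ψ z + η)) * Real.exp (g z) := by
      fun_prop
    have hhi : Integrable h := (integrable_indicator_iff measurableSet_closedBall).2
      (hhc.continuousOn.integrableOn_compact hBc)
    have hh0 : ∀ z, 0 ≤ h z := fun z => Set.indicator_nonneg (fun z _ => by
      have := hχ0 z
      positivity) z
    have hPL := entropy_add_le_integral_supConvolution ht0 ht1 hf hfc hf0 hF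
      (hucont.measurable.indicator measurableSet_closedBall) huint
      (fun y => Set.indicator_nonneg (fun y _ => Real.exp_nonneg _) y) (huU ▸ hU)
      (hhc.measurable.indicator measurableSet_closedBall) hhi hh0 (fun z y => by
        by_cases hy : ‖y‖ ≤ R
        swap
        · have : y ∉ Metric.closedBall (0 : EuclideanSpace ℝ (Fin n)) R := by simpa using hy
          simp only [Set.indicator_of_notMem this, Real.zero_rpow ht0.ne', mul_zero]
          exact hh0 z
        have hty : ‖t • y‖ ≤ t * R := by rw [norm_smul, Real.norm_of_nonneg ht0.le]; gcongr
        have htR : t * R ≤ R := by simpa using mul_le_mul_of_nonneg_right ht1.le hR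
        by_cases hz : ‖z‖ ≤ ρ + R
        swap
        · have : χ (z - t • y) = 0 := hχρ _ (by
            have := norm_sub_norm_le z (t • y)
            linarith)
          simp only [hfdef, this, zero_mul]
          exact hh0 z
        have hyB : y ∈ Metric.closedBall (0 : EuclideanSpace ℝ (Fin n)) R := by simpa using hy
        have hzB : z ∈ Metric.closedBall (0 : EuclideanSpace ℝ (Fin n)) (ρ + R) := by simpa using hz
        rw [Set.indicator_of_mem hyB, Set.indicator_of_mem hzB, ← Real.exp_mul]
        simp only [hfdef]
        rw [mul_assoc, ← Real.exp_add, mul_assoc, ← Real.exp_add]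
        refine mul_le_mul ?_ (Real.exp_le_exp.2 ?_) (Real.exp_nonneg _)
          (add_nonneg (hχ0 z) (by positivity))
        · refine (hχκ (z - t • y) z).trans ?_
          have : z - t • y - z = -(t • y) := by abel
          rw [this, norm_neg]
          calc χ z + κ * ‖t • y‖ ≤ χ z + κ * (t * R) := by gcongr
            _ = χ z + t * c := by ring
        · have h1 := hTaylor z y hz hy
          have h2 : inner ℝ (-gradient g z) y - φ y ≤ ψ z :=
            le_ciSup (bddAbove_legendre hφ hφlim (-gradient g z)) y
          rw [inner_neg_left] at h2
          have h3 := mul_le_mul_of_nonneg_left h2 ht0.le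
          linarith)
    rw [huU] at hPL
    have hfi : IntegrableOn f B := hf.continuousOn.integrableOn_compact hBc
    have hgB : IntegrableOn (fun x => Real.exp (g x)) B := hgi.integrableOn
    have hSi : IntegrableOn (fun x => χ x * (ψ x * Real.exp (g x))) B :=
      (hχ.mul (hψ.mul hgc.rexp)).continuousOn.integrableOn_compact hBc
    have hup : ∫ z, h z ≤ ∫ z in B, (f z + t * (χ z * (ψ z * Real.exp (g z)) + η * f z
        + c * Real.exp (g z)) + t ^ 2 * (C * Real.exp (g z))) := by
      rw [hh, integral_indicator measurableSet_closedBall]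
      refine setIntegral_mono_on (hhc.continuousOn.integrableOn_compact hBc) ?_
        measurableSet_closedBall fun z hz => ?_
      · exact (hfi.add (((hSi.add (hfi.const_mul η)).add (hgB.const_mul c)).const_mul t)).add
          ((hgB.const_mul C).const_mul _)
      · calc _ ≤ (χ z + t * (χ z * (ψ z + η) + c) + t ^ 2 * C) * Real.exp (g z) := by
              gcongr
              exact add_mul_exp_le (hχ0 z) (hχ1 z) hc ht0.le ht1.le (hK z hz) htK.le
          _ = _ := by simp only [hfdef]; ring
    have hcalc : ∫ z in B, (f z + t * (χ z * (ψ z * Real.exp (g z)) + η * f z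
        + c * Real.exp (g z)) + t ^ 2 * (C * Real.exp (g z))) =
        F + t * (P + η * F + c * ∫ z in B, Real.exp (g z))
          + t ^ 2 * (C * ∫ z in B, Real.exp (g z)) := by
      have e1 : ∫ z in B, f z = F := setIntegral_eq_integral_of_forall_compl_eq_zero fun x hx => by
        simp [hfdef, hfB x hx]
      have e2 : ∫ z in B, χ z * (ψ z * Real.exp (g z)) = P :=
        setIntegral_eq_integral_of_forall_compl_eq_zero fun x hx => by simp [hfB x hx]
      have i1 : IntegrableOn (fun z => χ z * (ψ z * Real.exp (g z)) + η * f z) B :=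
        hSi.add (hfi.const_mul η)
      have i2 : IntegrableOn (fun z => χ z * (ψ z * Real.exp (g z)) + η * f z
        + c * Real.exp (g z)) B := i1.add (hgB.const_mul c)
      have i3 : IntegrableOn (fun z => f z + t * (χ z * (ψ z * Real.exp (g z)) + η * f z
        + c * Real.exp (g z))) B := hfi.add (i2.const_mul t)
      rw [integral_add i3 ((hgB.const_mul C).const_mul _), integral_add hfi (i2.const_mul t),
        integral_const_mul, integral_const_mul, integral_const_mul,
        integral_add i1 (hgB.const_mul c), integral_add hSi (hfi.const_mul η),
        integral_const_mul, integral_const_mul, e1, e2]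
    have hBI : ∫ z in B, Real.exp (g z) ≤ I :=
      setIntegral_le_integral hgi (ae_of_all _ fun x => Real.exp_nonneg _)
    -- The zeroth-order terms `F` agree on both sides, so dividing by `t` leaves the first-order
    -- inequality.
    have hfin : F + t * (L - F * Real.log F + n * (1 - t) * F + F * Real.log U) ≤
        F + t * (P + c * I + η * F + t * (C * I)) := by
      refine (hPL.trans (hup.trans hcalc.le)).trans ?_
      calc _ ≤ F + t * (P + η * F + c * I) + t ^ 2 * (C * I) := by gcongr
        _ = _ := by ring
    exact le_of_mul_le_mul_left (by linarith) ht0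
  have lim1 : Tendsto (fun t : ℝ => L - F * Real.log F + n * (1 - t) * F + F * Real.log U)
      (nhdsWithin 0 (Set.Ioi 0)) (nhds (L - F * Real.log F + n * (1 - 0) * F + F * Real.log U)) :=
    (Continuous.tendsto (by fun_prop) 0).mono_left nhdsWithin_le_nhds
  have lim2 : Tendsto (fun t : ℝ => P + c * I + η * F + t * (C * I))
      (nhdsWithin 0 (Set.Ioi 0)) (nhds (P + c * I + η * F + 0 * (C * I))) :=
    (Continuous.tendsto (by fun_prop) 0).mono_left nhdsWithin_le_nhds
  simpa using le_of_tendsto_of_tendsto lim1 lim2 key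

/-! ### Removing the cutoffs -/

/-- A cutoff equal to `1` on the ball of radius `m` and to `0` off the ball of radius `2 * m`. -/
noncomputable def radialCutoff {E : Type*} [Norm E] (m : ℝ) (x : E) : ℝ :=
  max 0 (min 1 (2 - ‖x‖ / m))

section radialCutoff

variable {E : Type*} [NormedAddCommGroup E] {m : ℝ}

theorem continuous_radialCutoff : Continuous (radialCutoff m : E → ℝ) := by
  unfold radialCutoff; fun_prop

theorem radialCutoff_nonneg (x : E) : 0 ≤ radialCutoff m x := le_max_left _ _

theorem radialCutoff_le_one (x : E) : radialCutoff m x ≤ 1 :=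
  max_le zero_le_one (min_le_left _ _)

theorem radialCutoff_eq_one (hm : 0 < m) {x : E} (hx : ‖x‖ ≤ m) : radialCutoff m x = 1 := by
  have : ‖x‖ / m ≤ 1 := (div_le_one hm).2 hx
  rw [radialCutoff, min_eq_left (by linarith), max_eq_right zero_le_one]

theorem radialCutoff_eq_zero (hm : 0 < m) {x : E} (hx : 2 * m < ‖x‖) : radialCutoff m x = 0 := by
  have : 2 < ‖x‖ / m := (lt_div_iff₀ hm).2 hx
  rw [radialCutoff, min_eq_right (by linarith), max_eq_left (by linarith)]

theorem radialCutoff_le_add (hm : 0 < m) (x y : E) :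
    radialCutoff m x ≤ radialCutoff m y + m⁻¹ * ‖x - y‖ := by
  have hd : 0 ≤ m⁻¹ * ‖x - y‖ := by positivity
  refine max_le (add_nonneg (radialCutoff_nonneg y) hd) ?_
  refine le_trans ?_ (add_le_add_left (le_max_right _ _) _)
  rw [← min_add_add_right]
  refine min_le_min (by linarith) ?_
  have h1 : ‖y‖ ≤ ‖x‖ + ‖x - y‖ := by
    have := norm_sub_le x (x - y)
    simpa using this
  have h2 : ‖y‖ / m ≤ (‖x‖ + ‖x - y‖) / m := by gcongr
  rw [add_div, div_eq_inv_mul ‖x - y‖] at h2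
  linarith

theorem eventually_radialCutoff_eq_one (x : E) :
    ∀ᶠ k : ℕ in atTop, radialCutoff ((k : ℝ) + 1) x = 1 := by
  filter_upwards [tendsto_natCast_atTop_atTop.eventually_ge_atTop ‖x‖] with k hk
  exact radialCutoff_eq_one (by positivity) (hk.trans (by linarith))

end radialCutoff

/-- Dominated convergence along cutoffs of radius `k + 1`, whose Lipschitz constant `1 / (k + 1)`
kills the error term. -/
theorem entropy_le_of_ball {n : ℕ} {φ g : EuclideanSpace ℝ (Fin n) → ℝ} (hφ : Continuous φ)
    (hφlim : Tendsto (fun x => φ x / ‖x‖) (cocompact (EuclideanSpace ℝ (Fin n))) atTop)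
    (hg : ContDiff ℝ 1 g) (hgi : Integrable fun x => Real.exp (g x))
    (hggi : Integrable fun x => g x * Real.exp (g x))
    (hψi : Integrable fun x => legendre φ (-gradient g x) * Real.exp (g x))
    {R : ℝ} (hR : 0 ≤ R) (hU : 0 < ∫ x in Metric.closedBall 0 R, Real.exp (-φ x)) :
    (∫ x, g x * Real.exp (g x)) - (∫ x, Real.exp (g x)) * Real.log (∫ x, Real.exp (g x))
      + n * (∫ x, Real.exp (g x))
      + (∫ x, Real.exp (g x)) * Real.log (∫ x in Metric.closedBall 0 R, Real.exp (-φ x)) ≤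
    ∫ x, legendre φ (-gradient g x) * Real.exp (g x) := by
  have hgc : Continuous g := hg.continuous
  have hIpos : 0 < ∫ x, Real.exp (g x) := integral_exp_pos hgi
  set χ : ℕ → EuclideanSpace ℝ (Fin n) → ℝ := fun k => radialCutoff ((k : ℝ) + 1) with hχ
  have hχc : ∀ k, Continuous (χ k) := fun k => continuous_radialCutoff
  have hχ1 : ∀ k x, |χ k x| ≤ 1 := fun k x => by
    rw [abs_of_nonneg (radialCutoff_nonneg x)]; exact radialCutoff_le_one x
  have lim_mul : ∀ v : EuclideanSpace ℝ (Fin n) → ℝ, Integrable v →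
      Tendsto (fun k => ∫ x, χ k x * v x) atTop (nhds (∫ x, v x)) := fun v hv => by
    refine tendsto_integral_of_dominated_convergence (fun x => |v x|)
      (fun k => (hχc k).aestronglyMeasurable.mul hv.aestronglyMeasurable) hv.abs
      (fun k => ae_of_all _ fun x => ?_) (ae_of_all _ fun x => ?_)
    · rw [Real.norm_eq_abs, abs_mul]
      exact mul_le_of_le_one_left (abs_nonneg _) (hχ1 k x)
    · refine tendsto_const_nhds.congr' ?_
      filter_upwards [eventually_radialCutoff_eq_one x] with k hk
      simp [hχ, hk]
  have hF := lim_mul _ hgi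
  have hP := lim_mul _ hψi
  have hL : Tendsto (fun k => ∫ x, χ k x * Real.exp (g x) * Real.log (χ k x * Real.exp (g x)))
      atTop (nhds (∫ x, g x * Real.exp (g x))) := by
    refine tendsto_integral_of_dominated_convergence
      (fun x => |g x * Real.exp (g x)| + Real.exp (g x))
      (fun k => (Real.continuous_mul_log.comp ((hχc k).mul hgc.rexp)).aestronglyMeasurable)
      (hggi.abs.add hgi) (fun k => ae_of_all _ fun x => ?_) (ae_of_all _ fun x => ?_)
    -- Here `f log f = χ * g * exp g + (χ * log χ) * exp g`, and `|χ * log χ| ≤ 1` on `(0, 1]` gives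
    -- the dominating function.
    · rcases (radialCutoff_nonneg (m := (k : ℝ) + 1) x).eq_or_lt with h0 | h0
      · simp only [hχ, ← h0, zero_mul, norm_zero]; positivity
      · rw [Real.log_mul h0.ne' (Real.exp_ne_zero _), Real.log_exp]
        have h1 := (Real.abs_log_mul_self_lt _ h0 (radialCutoff_le_one x)).le
        calc ‖χ k x * Real.exp (g x) * (Real.log (χ k x) + g x)‖
            = |χ k x * (g x * Real.exp (g x)) + (Real.log (χ k x) * χ k x) * Real.exp (g x)| := by
              rw [Real.norm_eq_abs]; ring_nf
          _ ≤ |χ k x| * |g x * Real.exp (g x)| +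
              |Real.log (χ k x) * χ k x| * |Real.exp (g x)| := by
              rw [← abs_mul, ← abs_mul]; exact abs_add_le _ _
          _ ≤ 1 * |g x * Real.exp (g x)| + 1 * |Real.exp (g x)| := by
              gcongr
              exact hχ1 k x
          _ = _ := by rw [one_mul, one_mul, Real.abs_exp]
    · refine tendsto_const_nhds.congr' ?_
      filter_upwards [eventually_radialCutoff_eq_one x] with k hk
      simp [hχ, hk, mul_comm]
  have hFlog : Tendsto (fun k => (∫ x, χ k x * Real.exp (g x)) *
      Real.log (∫ x, χ k x * Real.exp (g x))) atTop
      (nhds ((∫ x, Real.exp (g x)) * Real.log (∫ x, Real.exp (g x)))) :=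
    (Real.continuous_mul_log.tendsto _).comp hF
  have hκ : Tendsto (fun k : ℕ => ((k : ℝ) + 1)⁻¹ * R * ∫ x, Real.exp (g x)) atTop
      (nhds (0 * R * ∫ x, Real.exp (g x))) :=
    ((tendsto_inv_atTop_zero.comp (tendsto_atTop_add_const_right _ _
      tendsto_natCast_atTop_atTop)).mul_const _).mul_const _
  have hlim := le_of_tendsto_of_tendsto
    (((hL.sub hFlog).add (hF.const_mul (n : ℝ))).add (hF.mul_const
      (Real.log (∫ x in Metric.closedBall 0 R, Real.exp (-φ x))))) (hP.add hκ) (by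
    filter_upwards [hF.eventually_const_lt hIpos] with k hk
    have hk1 : (0 : ℝ) < (k : ℝ) + 1 := by positivity
    refine le_of_forall_pos_le_add fun ε hε => ?_
    -- With `η = ε / F`, where `F` is the mass of the cut-off function, the Taylor error `η * F` is
    -- exactly `ε`.
    have := entropy_cutoff_le_add hφ hφlim hg (R := R) (ρ := 2 * ((k : ℝ) + 1))
      (η := ε / ∫ x, χ k x * Real.exp (g x)) (κ := ((k : ℝ) + 1)⁻¹) (χ := χ k) hR (by positivity)
      (div_pos hε hk) (by positivity) hU (hχc k) radialCutoff_nonneg radialCutoff_le_one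
      (fun x => radialCutoff_eq_zero hk1) (radialCutoff_le_add hk1) hk hgi
    rwa [div_mul_cancel₀ _ hk.ne'] at this)
  simpa using hlim

/-- The entropy inequality for a continuous superlinear `φ`, with `∫ exp (-φ)` not normalized. -/
theorem entropy_le_of_superlinear {n : ℕ} {φ g : EuclideanSpace ℝ (Fin n) → ℝ} (hφ : Continuous φ)
    (hφlim : Tendsto (fun x => φ x / ‖x‖) (cocompact (EuclideanSpace ℝ (Fin n))) atTop)
    (hφi : Integrable fun x => Real.exp (-φ x))
    (hg : ContDiff ℝ 1 g) (hgi : Integrable fun x => Real.exp (g x))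
    (hggi : Integrable fun x => g x * Real.exp (g x))
    (hψi : Integrable fun x => legendre φ (-gradient g x) * Real.exp (g x)) :
    (∫ x, g x * Real.exp (g x)) - (∫ x, Real.exp (g x)) * Real.log (∫ x, Real.exp (g x))
      + n * (∫ x, Real.exp (g x)) + (∫ x, Real.exp (g x)) * Real.log (∫ x, Real.exp (-φ x)) ≤
    ∫ x, legendre φ (-gradient g x) * Real.exp (g x) := by
  have hU : 0 < ∫ x, Real.exp (-φ x) := integral_exp_pos hφi
  have hUk : Tendsto (fun k : ℕ => ∫ x in Metric.closedBall 0 (k : ℝ), Real.exp (-φ x)) atTop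
      (nhds (∫ x, Real.exp (-φ x))) :=
    (aecover_closedBall tendsto_natCast_atTop_atTop).integral_tendsto_of_countably_generated hφi
  refine le_of_tendsto (((hUk.log hU.ne').const_mul _).const_add _) ?_
  filter_upwards [hUk.eventually_const_lt hU] with k hk
  exact entropy_le_of_ball hφ hφlim hg hgi hggi hψi k.cast_nonneg hk

/-! ### Rescaling by `λ` -/

theorem entropy_exp_eq {α : Type*} [MeasurableSpace α] {μ : Measure α} [NeZero μ] {g : α → ℝ}
    (hgi : Integrable (fun x => Real.exp (g x)) μ)
    (hggi : Integrable (fun x => g x * Real.exp (g x)) μ) :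
    entropy μ (fun x => Real.exp (g x)) = (∫ x, g x * Real.exp (g x) ∂μ) -
      (∫ x, Real.exp (g x) ∂μ) * Real.log (∫ x, Real.exp (g x) ∂μ) := by
  have hI : 0 < ∫ x, Real.exp (g x) ∂μ := integral_exp_pos hgi
  rw [entropy, ← integral_mul_const, ← integral_sub hggi (hgi.mul_const _)]
  congr 1 with x
  rw [Real.log_div (Real.exp_ne_zero _) hI.ne', Real.log_exp]
  ring

theorem legendre_comp_inv_smul {n : ℕ} (φ : EuclideanSpace ℝ (Fin n) → ℝ) {c : ℝ} (hc : c ≠ 0)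
    (w : EuclideanSpace ℝ (Fin n)) :
    legendre (fun y => φ (c⁻¹ • y)) w = legendre φ (c • w) := by
  have hs : Function.Surjective fun z : EuclideanSpace ℝ (Fin n) => c • z :=
    fun z => ⟨c⁻¹ • z, smul_inv_smul₀ hc z⟩
  rw [legendre, legendre, ← hs.iSup_comp]
  congr 1 with z
  rw [inv_smul_smul₀ hc, real_inner_smul_left, real_inner_smul_right]

theorem tendsto_comp_inv_smul_div_norm {E : Type*} [NormedAddCommGroup E] [NormedSpace ℝ E]
    {φ : E → ℝ} (hφlim : Tendsto (fun x => φ x / ‖x‖) (cocompact E) atTop) {c : ℝ} (hc : 0 < c) :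
    Tendsto (fun x => φ (c⁻¹ • x) / ‖x‖) (cocompact E) atTop := by
  have h1 : Tendsto (fun x : E => c⁻¹ • x) (cocompact E) (cocompact E) :=
    (Homeomorph.smulOfNeZero c⁻¹ (inv_ne_zero hc.ne')).isClosedEmbedding.tendsto_cocompact
  refine ((hφlim.comp h1).const_mul_atTop (inv_pos.2 hc)).congr fun x => ?_
  simp only [Function.comp_apply, norm_smul, norm_inv, Real.norm_of_nonneg hc.le]
  rcases eq_or_ne ‖x‖ 0 with h | h
  · simp [h]
  · field_simp

/-- The unnormalized inequality is applied to `φ (c⁻¹ • ·)`, for which `∫ exp (-φ (c⁻¹ • x)) = c ^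
n`; its logarithm and the term `n` combine into `n * log (c * e)`. -/
theorem entropy_exp_le_legendre {n : ℕ} {φ g : EuclideanSpace ℝ (Fin n) → ℝ} (hφ : Continuous φ)
    (hφlim : Tendsto (fun x => φ x / ‖x‖) (cocompact (EuclideanSpace ℝ (Fin n))) atTop)
    (hφint : ∫ x, Real.exp (-φ x) = 1) {c : ℝ} (hc : 0 < c)
    (hg : ContDiff ℝ 1 g) (hgi : Integrable fun x => Real.exp (g x))
    (hggi : Integrable fun x => g x * Real.exp (g x))
    (hψi : Integrable fun x => legendre φ (-(c • gradient g x)) * Real.exp (g x)) :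
    entropy volume (fun x => Real.exp (g x)) ≤
      -(n : ℝ) * Real.log (c * Real.exp 1) * (∫ x, Real.exp (g x))
        + ∫ x, legendre φ (-(c • gradient g x)) * Real.exp (g x) := by
  have hφi : Integrable fun x => Real.exp (-φ x) := by
    by_contra h
    rw [integral_undef h] at hφint
    exact zero_ne_one hφint
  have hleg : ∀ x, legendre φ (-(c • gradient g x)) =
      legendre (fun y => φ (c⁻¹ • y)) (-gradient g x) := fun x => by
    rw [legendre_comp_inv_smul φ hc.ne', smul_neg]
  have hint : ∫ x : EuclideanSpace ℝ (Fin n), Real.exp (-φ (c⁻¹ • x)) = c ^ n := by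
    rw [Measure.integral_comp_inv_smul volume (fun x => Real.exp (-φ x)), hφint,
      finrank_euclideanSpace_fin, abs_of_pos (by positivity), smul_eq_mul, mul_one]
  simp only [hleg] at hψi ⊢
  have key := entropy_le_of_superlinear (hφ.comp (continuous_const_smul c⁻¹))
    (tendsto_comp_inv_smul_div_norm hφlim hc) (hφi.comp_smul (inv_ne_zero hc.ne')) hg hgi hggi hψi
  simp only [Function.comp_def] at key
  rw [hint, Real.log_pow] at key
  rw [entropy_exp_eq hgi hggi, Real.log_mul hc.ne' (Real.exp_ne_zero _), Real.log_exp]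
  linarith

/-! ### The equality case -/

theorem ConvexOn.inner_gradient_le {E : Type*} [NormedAddCommGroup E] [InnerProductSpace ℝ E]
    [CompleteSpace E] {φ : E → ℝ} (hφ : ConvexOn ℝ Set.univ φ) {x : E}
    (hd : DifferentiableAt ℝ φ x) (z : E) :
    φ x + inner ℝ (gradient φ x) (z - x) ≤ φ z := by
  rw [inner_gradient_left]
  have hlim := (hd.hasFDerivAt.hasLineDerivAt (z - x)).tendsto_slope_zero_right
  have : fderiv ℝ φ x (z - x) ≤ φ z - φ x := by
    refine le_of_tendsto hlim ?_
    filter_upwards [Ioo_mem_nhdsGT (zero_lt_one' ℝ)] with t ht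
    have h1 := hφ.2 (Set.mem_univ x) (Set.mem_univ z)
      (show 0 ≤ 1 - t by linarith [ht.2]) ht.1.le (by ring)
    have h2 : (1 - t) • x + t • z = x + t • (z - x) := by module
    rw [h2, smul_eq_mul, smul_eq_mul] at h1
    rw [smul_eq_mul, inv_mul_le_iff₀ ht.1]
    linarith
  linarith

/-- Equality in Fenchel-Young: the tangent plane at `x` lies below `φ`, so the supremum is attained
at `z = x`. -/
theorem legendre_gradient {n : ℕ} {φ : EuclideanSpace ℝ (Fin n) → ℝ}
    (hφ : ConvexOn ℝ Set.univ φ) {x : EuclideanSpace ℝ (Fin n)} (hd : DifferentiableAt ℝ φ x) :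
    legendre φ (gradient φ x) = inner ℝ (gradient φ x) x - φ x := by
  have hle : ∀ z, inner ℝ (gradient φ x) z - φ z ≤ inner ℝ (gradient φ x) x - φ x := fun z => by
    have := hφ.inner_gradient_le hd z
    rw [inner_sub_right] at this
    linarith
  exact le_antisymm (ciSup_le hle) (le_ciSup (f := fun z => inner ℝ (gradient φ x) z - φ z)
    ⟨_, by rintro _ ⟨z, rfl⟩; exact hle z⟩ x)

theorem abs_mul_exp_neg_le {y A : ℝ} (hA : 0 ≤ A) (hy : -A ≤ y) :
    |y| * Real.exp (-y) ≤ (2 + A * Real.exp (A / 2)) * Real.exp (-y / 2) := by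
  have h1 : Real.exp (-y) = Real.exp (-y / 2) * Real.exp (-y / 2) := by
    rw [← Real.exp_add]; ring_nf
  rw [h1, ← mul_assoc]
  gcongr
  rcases le_total 0 y with h | h
  · rw [abs_of_nonneg h]
    have h2 : y / 2 ≤ Real.exp (y / 2) := by linarith [Real.add_one_le_exp (y / 2)]
    have h3 : Real.exp (y / 2) * Real.exp (-y / 2) = 1 := by rw [← Real.exp_add]; ring_nf; simp
    calc y * Real.exp (-y / 2) = 2 * (y / 2 * Real.exp (-y / 2)) := by ring
      _ ≤ 2 * (Real.exp (y / 2) * Real.exp (-y / 2)) := by gcongr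
      _ = 2 := by rw [h3, mul_one]
      _ ≤ _ := by linarith [mul_nonneg hA (Real.exp_nonneg (A / 2))]
  · rw [abs_of_nonpos h]
    have : -y * Real.exp (-y / 2) ≤ A * Real.exp (A / 2) := by gcongr <;> linarith
    linarith

/-- Half of the exponential absorbs the factor `φ`. The other half is integrable because `φ (x / 2)
≤ φ x / 2 + φ 0 / 2` bounds it by a dilate of `exp (-φ)`. -/
theorem ConvexOn.integrable_mul_exp_neg {n : ℕ} {φ : EuclideanSpace ℝ (Fin n) → ℝ}
    (hconv : ConvexOn ℝ Set.univ φ) (hφ : Continuous φ) (hbdd : BddBelow (Set.range φ))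
    (hφi : Integrable fun x => Real.exp (-φ x)) :
    Integrable fun x => φ x * Real.exp (-φ x) := by
  obtain ⟨b, hb⟩ := hbdd
  have hb : ∀ x, b ≤ φ x := fun x => hb ⟨x, rfl⟩
  have hhalf : Integrable fun x => Real.exp (-φ ((1 / 2 : ℝ) • x)) :=
    hφi.comp_smul (by norm_num)
  refine (hhalf.const_mul ((2 + |b| * Real.exp (|b| / 2)) * Real.exp (φ 0 / 2))).mono'
    (by fun_prop) (ae_of_all _ fun x => ?_)
  have h1 : φ ((1 / 2 : ℝ) • x) ≤ φ x / 2 + φ 0 / 2 := by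
    have := hconv.2 (Set.mem_univ x) (Set.mem_univ 0)
      (show (0 : ℝ) ≤ 1 / 2 by norm_num) (show (0 : ℝ) ≤ 1 / 2 by norm_num) (by norm_num)
    rw [smul_zero, add_zero, smul_eq_mul, smul_eq_mul] at this
    linarith
  rw [Real.norm_eq_abs, abs_mul, Real.abs_exp, mul_assoc, ← Real.exp_add]
  refine (abs_mul_exp_neg_le (abs_nonneg b) ((neg_abs_le b).trans (hb x))).trans ?_
  gcongr
  linarith

theorem lintegral_ofReal_le_of_tendsto {α : Type*} [MeasurableSpace α] {μ : Measure α}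
    {f : ℕ → α → ℝ} {F : α → ℝ} {a : ℕ → ℝ} {A : ℝ} (hf : ∀ k, Measurable (f k))
    (hfi : ∀ k, Integrable (f k) μ) (hf0 : ∀ k x, 0 ≤ f k x) (ha : ∀ k, ∫ x, f k x ∂μ = a k)
    (hlim : ∀ x, Tendsto (fun k => f k x) atTop (nhds (F x))) (hA : Tendsto a atTop (nhds A)) :
    ∫⁻ x, ENNReal.ofReal (F x) ∂μ ≤ ENNReal.ofReal A := by
  have h1 := lintegral_liminf_le (μ := μ) (u := atTop) fun k => (hf k).ennreal_ofReal
  have h2 : ∀ k, ∫⁻ x, ENNReal.ofReal (f k x) ∂μ = ENNReal.ofReal (a k) := fun k => by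
    rw [← ha, ofReal_integral_eq_lintegral_ofReal (hfi k) (ae_of_all _ (hf0 k))]
  simp only [h2] at h1
  rw [(ENNReal.tendsto_ofReal hA).liminf_eq] at h1
  refine le_trans (lintegral_mono fun x => ?_) h1
  exact (ENNReal.tendsto_ofReal (hlim x)).liminf_eq.ge

/-- Formally an integration by parts, `∫ (x · ∇φ) exp (-φ) = n`. Boundary terms are avoided by using
difference quotients under dilation, whose integrals are explicit, and Fatou's lemma, which yields
integrability as well as the bound. -/
theorem integrable_legendre_gradient_and_integral_le {n : ℕ} {φ : EuclideanSpace ℝ (Fin n) → ℝ}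
    (hφ : ContDiff ℝ 1 φ) (hconv : ConvexOn ℝ Set.univ φ)
    (hφlim : Tendsto (fun x => φ x / ‖x‖) (cocompact (EuclideanSpace ℝ (Fin n))) atTop)
    (hφint : ∫ x, Real.exp (-φ x) = 1) (hφi : Integrable fun x => Real.exp (-φ x))
    (hφφi : Integrable fun x => φ x * Real.exp (-φ x)) :
    Integrable (fun x => legendre φ (gradient φ x) * Real.exp (-φ x)) ∧
    ∫ x, legendre φ (gradient φ x) * Real.exp (-φ x) ≤ n - ∫ x, φ x * Real.exp (-φ x) := by
  have hφc := hφ.continuous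
  have hψc : Continuous fun x => legendre φ (gradient φ x) :=
    (continuous_legendre hφc hφlim).comp (continuous_gradient hφ)
  have hψ0 : ∀ x, 0 ≤ legendre φ (gradient φ x) + φ 0 := fun x => by
    have := le_ciSup (bddAbove_legendre hφc hφlim (gradient φ x)) 0
    rw [inner_zero_right] at this
    simp only [legendre]
    linarith
  -- The `+ 2` keeps `ε k < 1` even at `k = 0`.
  set ε : ℕ → ℝ := fun k => 1 / ((k : ℝ) + 2) with hε
  have hε0 : ∀ k, 0 < ε k := fun k => by positivity
  have hε1 : ∀ k, ε k < 1 := fun k => by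
    simp only [hε]
    rw [div_lt_one (by positivity)]
    linarith [k.cast_nonneg (α := ℝ)]
  have hεlim : Tendsto ε atTop (nhdsWithin 0 {0}ᶜ) := by
    refine tendsto_nhdsWithin_iff.2 ⟨?_, Eventually.of_forall fun k => (hε0 k).ne'⟩
    exact tendsto_const_nhds.div_atTop
      (tendsto_atTop_add_const_right _ _ tendsto_natCast_atTop_atTop)
  -- The term `φ 0 * exp (-φ x)` is added to make `D k` nonnegative: `φ ((1 - ε) • x) ≤ (1 - ε) * φ
  -- x + ε * φ 0` by convexity, and `exp` lies above its tangent.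
  set D : ℕ → EuclideanSpace ℝ (Fin n) → ℝ := fun k x =>
    (ε k)⁻¹ * (Real.exp (-φ ((1 - ε k) • x)) - Real.exp (-φ x)) - φ x * Real.exp (-φ x)
      + φ 0 * Real.exp (-φ x) with hD
  have hDi1 : ∀ k, Integrable fun x => Real.exp (-φ ((1 - ε k) • x)) := fun k =>
    hφi.comp_smul (sub_pos.2 (hε1 k)).ne'
  have hDi2 : ∀ k, Integrable fun x =>
      (ε k)⁻¹ * (Real.exp (-φ ((1 - ε k) • x)) - Real.exp (-φ x)) := fun k =>
    ((hDi1 k).sub hφi).const_mul _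
  have hDi3 : ∀ k, Integrable fun x =>
      (ε k)⁻¹ * (Real.exp (-φ ((1 - ε k) • x)) - Real.exp (-φ x)) - φ x * Real.exp (-φ x) :=
    fun k => (hDi2 k).sub hφφi
  have hDi : ∀ k, Integrable (D k) := fun k => (hDi3 k).add (hφi.const_mul _)
  have hDint : ∀ k, ∫ x, D k x =
      (ε k)⁻¹ * (((1 - ε k) ^ n)⁻¹ - 1) - (∫ x, φ x * Real.exp (-φ x)) + φ 0 := fun k => by
    have hpos : 0 < 1 - ε k := sub_pos.2 (hε1 k)
    have hs : ∫ x : EuclideanSpace ℝ (Fin n), Real.exp (-φ ((1 - ε k) • x)) =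
        ((1 - ε k) ^ n)⁻¹ := by
      rw [Measure.integral_comp_smul volume (fun x => Real.exp (-φ x)), hφint,
        finrank_euclideanSpace_fin, abs_of_pos (by positivity), smul_eq_mul, mul_one]
    simp only [hD]
    rw [integral_add (hDi3 k) (hφi.const_mul _), integral_sub (hDi2 k) hφφi, integral_const_mul,
      integral_const_mul, integral_sub (hDi1 k) hφi, hs, hφint, mul_one]
  have hD0 : ∀ k x, 0 ≤ D k x := fun k x => by
    have h1 := hconv.2 (Set.mem_univ x) (Set.mem_univ 0)
      (sub_pos.2 (hε1 k)).le (hε0 k).le (by ring)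
    rw [smul_zero, add_zero, smul_eq_mul, smul_eq_mul] at h1
    have h2 : Real.exp (-φ x) * (φ x - φ ((1 - ε k) • x)) ≤
        Real.exp (-φ ((1 - ε k) • x)) - Real.exp (-φ x) := by
      have h3 := Real.add_one_le_exp (φ x - φ ((1 - ε k) • x))
      have h4 : Real.exp (-φ ((1 - ε k) • x)) =
          Real.exp (-φ x) * Real.exp (φ x - φ ((1 - ε k) • x)) := by
        rw [← Real.exp_add]; ring_nf
      rw [h4]
      calc _ = Real.exp (-φ x) * (φ x - φ ((1 - ε k) • x) + 1) - Real.exp (-φ x) := by ring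
        _ ≤ _ := by gcongr
    have h5 : Real.exp (-φ x) * (ε k * (φ x - φ 0)) ≤
        Real.exp (-φ x) * (φ x - φ ((1 - ε k) • x)) := by
      gcongr
      linarith
    have h6 : Real.exp (-φ x) * (φ x - φ 0) ≤
        (ε k)⁻¹ * (Real.exp (-φ ((1 - ε k) • x)) - Real.exp (-φ x)) := by
      rw [le_inv_mul_iff₀ (hε0 k)]
      linarith
    simp only [hD]
    linarith
  have hDlim : ∀ x, Tendsto (fun k => D k x) atTop
      (nhds ((legendre φ (gradient φ x) + φ 0) * Real.exp (-φ x))) := fun x => by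
    have hd : DifferentiableAt ℝ φ x := hφ.differentiable one_ne_zero x
    have hline : HasDerivAt (fun e : ℝ => φ (x + e • (-x))) (fderiv ℝ φ x (-x)) 0 :=
      hd.hasFDerivAt.hasLineDerivAt (-x)
    have h1 := (hline.neg.exp.tendsto_slope_zero.comp hεlim).sub_const (φ x * Real.exp (-φ x))
    have h2 := h1.add_const (φ 0 * Real.exp (-φ x))
    rw [legendre_gradient hconv hd, inner_gradient_left]
    refine (h2.congr fun k => ?_).trans_eq ?_
    · have h3 : x + ε k • (-x) = (1 - ε k) • x := by module
      simp only [Function.comp_apply, Pi.neg_apply, hD, zero_add, zero_smul, add_zero,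
        smul_eq_mul, h3]
    · simp only [Pi.neg_apply, zero_smul, add_zero, map_neg]
      congr 1
      ring
  have hAlim : Tendsto (fun k => (ε k)⁻¹ * (((1 - ε k) ^ n)⁻¹ - 1)
      - (∫ x, φ x * Real.exp (-φ x)) + φ 0) atTop
      (nhds (n - (∫ x, φ x * Real.exp (-φ x)) + φ 0)) := by
    refine Tendsto.add_const _ (Tendsto.sub_const ?_ _)
    have hder : HasDerivAt (fun e : ℝ => ((1 - e) ^ n)⁻¹) n 0 :=
      ((((hasDerivAt_id (0 : ℝ)).const_sub 1).pow n).inv (by simp)).congr_deriv (by simp)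
    have := hder.tendsto_slope_zero.comp hεlim
    simpa [Function.comp_def] using this
  have hlint := lintegral_ofReal_le_of_tendsto (fun k => by
    have : Continuous (D k) := by simp only [hD]; fun_prop
    exact this.measurable) hDi hD0 hDint hDlim hAlim
  have hG0 : ∀ x, 0 ≤ (legendre φ (gradient φ x) + φ 0) * Real.exp (-φ x) := fun x =>
    mul_nonneg (hψ0 x) (Real.exp_nonneg _)
  have hGc : Continuous fun x => (legendre φ (gradient φ x) + φ 0) * Real.exp (-φ x) := by
    fun_prop
  have hGi : Integrable fun x => (legendre φ (gradient φ x) + φ 0) * Real.exp (-φ x) := by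
    refine ⟨hGc.aestronglyMeasurable, ?_⟩
    rw [hasFiniteIntegral_iff_ofReal (ae_of_all _ hG0)]
    exact hlint.trans_lt ENNReal.ofReal_lt_top
  have hA0 : 0 ≤ n - (∫ x, φ x * Real.exp (-φ x)) + φ 0 :=
    ge_of_tendsto' hAlim fun k => hDint k ▸ integral_nonneg (hD0 k)
  rw [← ofReal_integral_eq_lintegral_ofReal hGi (ae_of_all _ hG0),
    ENNReal.ofReal_le_ofReal_iff hA0] at hlint
  have heq : ∀ x, legendre φ (gradient φ x) * Real.exp (-φ x) =
      (legendre φ (gradient φ x) + φ 0) * Real.exp (-φ x) - φ 0 * Real.exp (-φ x) :=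
    fun x => by ring
  simp only [heq]
  refine ⟨hGi.sub (hφi.const_mul _), ?_⟩
  rw [integral_sub hGi (hφi.const_mul _), integral_const_mul, hφint]
  linarith

theorem gradient_neg_comp_sub {E : Type*} [NormedAddCommGroup E] [InnerProductSpace ℝ E]
    [CompleteSpace E] (φ : E → ℝ) (x₀ x : E) :
    gradient (fun y => -φ (y - x₀)) x = -gradient φ (x - x₀) := by
  rw [gradient, gradient, fderiv_fun_neg, fderiv_comp_sub, map_neg]

theorem mainTheorem5 (n : ℕ) (φ : EuclideanSpace ℝ (Fin n) → ℝ)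
    (hφ_smooth : ContDiff ℝ 1 φ)
    (hφ_convex : StrictConvexOn ℝ Set.univ φ)
    (hφ_lim : Tendsto (fun x => φ x / ‖x‖) (cocompact (EuclideanSpace ℝ (Fin n))) atTop)
    (hφ_int : ∫ x, Real.exp (-φ x) = 1) :
    (∀ lam : ℝ, 0 < lam → ∀ g : EuclideanSpace ℝ (Fin n) → ℝ, ContDiff ℝ 1 g →
      Integrable (fun x => Real.exp (g x)) volume →
      Integrable (fun x => g x * Real.exp (g x)) volume →
      Integrable (fun x => legendre φ (-(lam • gradient g x)) * Real.exp (g x)) volume →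
      entropy volume (fun x => Real.exp (g x)) ≤
        -(n : ℝ) * Real.log (lam * Real.exp 1) * (∫ x, Real.exp (g x))
          + ∫ x, legendre φ (-(lam • gradient g x)) * Real.exp (g x)) ∧
    (∀ (x₀ : EuclideanSpace ℝ (Fin n)) (g : EuclideanSpace ℝ (Fin n) → ℝ),
      (∀ x, g x = -φ (x - x₀)) →
      Integrable (fun x => Real.exp (g x)) volume ∧
      Integrable (fun x => g x * Real.exp (g x)) volume ∧
      Integrable (fun x => legendre φ (-((1 : ℝ) • gradient g x)) * Real.exp (g x)) volume ∧
      entropy volume (fun x => Real.exp (g x)) =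
        -(n : ℝ) * Real.log (1 * Real.exp 1) * (∫ x, Real.exp (g x))
          + ∫ x, legendre φ (-((1 : ℝ) • gradient g x)) * Real.exp (g x)) := by
  have hφc := hφ_smooth.continuous
  have hφi : Integrable fun x => Real.exp (-φ x) := by
    by_contra h
    rw [integral_undef h] at hφ_int
    exact zero_ne_one hφ_int
  have ineq : ∀ lam : ℝ, 0 < lam → ∀ g : EuclideanSpace ℝ (Fin n) → ℝ, ContDiff ℝ 1 g →
      Integrable (fun x => Real.exp (g x)) volume →
      Integrable (fun x => g x * Real.exp (g x)) volume →
      Integrable (fun x => legendre φ (-(lam • gradient g x)) * Real.exp (g x)) volume →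
      entropy volume (fun x => Real.exp (g x)) ≤
        -(n : ℝ) * Real.log (lam * Real.exp 1) * (∫ x, Real.exp (g x))
          + ∫ x, legendre φ (-(lam • gradient g x)) * Real.exp (g x) :=
    fun lam hlam g hg h1 h2 h3 => entropy_exp_le_legendre hφc hφ_lim hφ_int hlam hg h1 h2 h3
  refine ⟨ineq, fun x₀ g hg => ?_⟩
  obtain rfl : g = fun x => -φ (x - x₀) := funext hg
  -- Finiteness of `φ*` at `0` bounds `-φ` from above.
  have hbdd : BddBelow (Set.range φ) := by
    obtain ⟨b, hb⟩ := bddAbove_legendre hφc hφ_lim 0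
    refine ⟨-b, ?_⟩
    rintro _ ⟨z, rfl⟩
    have := hb ⟨z, rfl⟩
    simp only [inner_zero_left] at this
    linarith
  have hφφi := hφ_convex.convexOn.integrable_mul_exp_neg hφc hbdd hφi
  obtain ⟨hψi, hψle⟩ := integrable_legendre_gradient_and_integral_le hφ_smooth
    hφ_convex.convexOn hφ_lim hφ_int hφi hφφi
  have hgrad : ∀ x, -((1 : ℝ) • gradient (fun y => -φ (y - x₀)) x) = gradient φ (x - x₀) :=
    fun x => by rw [one_smul, gradient_neg_comp_sub, neg_neg]
  have i1 : Integrable fun x => Real.exp (-φ (x - x₀)) := hφi.comp_sub_right x₀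
  have i2 : Integrable fun x => -φ (x - x₀) * Real.exp (-φ (x - x₀)) := by
    simp only [neg_mul]
    exact (hφφi.comp_sub_right x₀).neg
  have i3 : Integrable fun x => legendre φ (-((1 : ℝ) • gradient (fun y => -φ (y - x₀)) x)) *
      Real.exp (-φ (x - x₀)) := by
    simp only [hgrad]
    exact hψi.comp_sub_right x₀
  -- One direction is the inequality at `λ = 1`; the other reduces, by translation invariance, to
  -- `hψle`.
  refine ⟨i1, i2, i3, le_antisymm (ineq 1 one_pos _ (by fun_prop) i1 i2 i3) ?_⟩
  have e1 : ∫ x, Real.exp (-φ (x - x₀)) = 1 := by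
    rw [integral_sub_right_eq_self (fun x => Real.exp (-φ x)), hφ_int]
  have e2 : ∫ x, -φ (x - x₀) * Real.exp (-φ (x - x₀)) = -∫ x, φ x * Real.exp (-φ x) := by
    rw [integral_sub_right_eq_self (fun x => -φ x * Real.exp (-φ x)), ← integral_neg]
    simp only [neg_mul]
  rw [entropy_exp_eq i1 i2, e1, e2]
  simp only [hgrad]
  rw [integral_sub_right_eq_self (fun x => legendre φ (gradient φ x) * Real.exp (-φ x)), one_mul,
    Real.log_exp, Real.log_one]
  linarith
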